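/- A rack is a set $X$ with a binary operation $(x,y)\mapsto x^y$ such that for every $y \in X$ the map $x \mapsto x^y$ is a bijection of $X$, and $(z^x)^y = (z^y)^{x^y}$ for all $x,y,z \in X$; it is a quandle if moreover $x^x = x$ for all $x \in X$. A finite rack $X$ is connected if the directed graph with vertex set $X$ and edges $(x, x^y)$, $x,y\in X$, is connected. Elements $x_1,\dots,x_n$ of a finite rack $X$ generate $X$ if the only subset $X_0 \subseteq X$ that contains them and satisfies $x^y \in X_0$ for all $x,y\in X_0$ is $X$ itself. The braid group $$B_n = \langle \sigma_1,\dots,\sigma_{n-1} : \sigma_i\sigma_j=\sigma_j\sigma_i \text{ for } i>j+1,\ \sigma_i\sigma_{i+1}\sigma_i=\sigma_{i+1}\sigma_i\sigma_{i+1} \text{ for } i<n-1\rangle$$ acts from the right on $X^n$ by $$(x_1,\dots,x_n)^{\sigma_i} = (x_1,\dots,x_{i-1},\,x_{i+1},\,x_i^{x_{i+1}},\,x_{i+2},\dots,x_n),$$ and maps homomorphically to the symmetric group $S_n$ by $\sigma_i \mapsto (i\ \ i+1)$. **Theorem.** Let $X$ be a connected finite rack, let $n$ be a positive integer that is sufficiently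 large (in terms of $|X|$ only), and let $(x_1,\dots,x_n)\in X^n$ be a tuple whose entries generate $X$. Let $H \le S_n$ be the image, under the homomorphism $B_n \to S_n$, of the stabilizer of $(x_1,\dots,x_n)$ in $B_n$. Then $H$ is either the alternating group $A_n$ or the symmetric group $S_n$. If moreover $X$ is a quandle, then $H = S_n$. -/

import Mathlib

open scoped Quandles

universe u

/-! ### The braid group and its homomorphism to the symmetric group -/

namespace Braid

/-- The left one of the two adjacent positions (numbered from `0`) that the generator `σ_i`
exchanges. -/
def left {n : ℕ} (i : Fin (n - 1)) : Fin n := ⟨i, by omega⟩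

/-- The right one of the two adjacent positions (numbered from `0`) that the generator `σ_i`
exchanges. -/
def right {n : ℕ} (i : Fin (n - 1)) : Fin n := ⟨i + 1, by omega⟩

/-- The braid relations: `σ_i σ_j = σ_j σ_i` for `i > j + 1`, and
`σ_i σ_{i+1} σ_i = σ_{i+1} σ_i σ_{i+1}`. -/
inductive IsRelator (n : ℕ) : FreeGroup (Fin (n - 1)) → Prop
  | comm (i j : Fin (n - 1)) (h : (j : ℕ) + 1 < i) :
      IsRelator n ((FreeGroup.of i * FreeGroup.of j) * (FreeGroup.of j * FreeGroup.of i)⁻¹)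
  | braid (i j : Fin (n - 1)) (h : (i : ℕ) + 1 = j) :
      IsRelator n ((FreeGroup.of i * FreeGroup.of j * FreeGroup.of i) *
        (FreeGroup.of j * FreeGroup.of i * FreeGroup.of j)⁻¹)

end Braid

/-- The braid group `B_n` on `n` strands, by its standard presentation with generators
`σ_1, …, σ_{n-1}` (here numbered from `0`). -/
abbrev BraidGroup (n : ℕ) : Type := PresentedGroup {r | Braid.IsRelator n r}

namespace Braid

/-- The standard generator `σ_i` of the braid group. -/
def sigma {n : ℕ} (i : Fin (n - 1)) : BraidGroup n := PresentedGroup.of i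

theorem right_ne_left {n : ℕ} (i : Fin (n - 1)) : right i ≠ left i := by
  simp [left, right, Fin.ext_iff]

theorem toPerm_relator {n : ℕ} (r : FreeGroup (Fin (n - 1))) (hr : IsRelator n r) :
    FreeGroup.lift (fun i => Equiv.swap (left i) (right i)) r = 1 := by
  cases hr with
  | comm i j h =>
    simp only [map_mul, map_inv, FreeGroup.lift_apply_of, mul_inv_eq_one]
    refine (Equiv.Perm.disjoint_swap_swap ?_).commute.eq
    simp [left, right]
    omega
  | braid i j h =>
    simp only [map_mul, map_inv, FreeGroup.lift_apply_of, mul_inv_eq_one]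
    have hl : left j = right i := by simp [left, right, h]
    have h1 : right i ≠ left i := right_ne_left i
    have h2 : right j ≠ right i := by simp [right, Fin.ext_iff]; omega
    have h3 : right j ≠ left i := by simp [left, right, Fin.ext_iff]; omega
    rw [hl]
    rw [Equiv.swap_mul_swap_mul_swap h1.symm h3.symm, Equiv.swap_comm (left i),
      Equiv.swap_comm (right i) (right j), Equiv.swap_mul_swap_mul_swap h2 h3, Equiv.swap_comm]

/-- The homomorphism `B_n → S_n` that maps `σ_i` to the transposition `(i  i+1)`. -/
def toPerm (n : ℕ) : BraidGroup n →* Equiv.Perm (Fin n) :=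
  PresentedGroup.toGroup (f := fun i => Equiv.swap (left i) (right i)) toPerm_relator

@[simp] theorem toPerm_sigma {n : ℕ} (i : Fin (n - 1)) :
    toPerm n (sigma i) = Equiv.swap (left i) (right i) :=
  PresentedGroup.toGroup.of _

/-! ### The right action of the braid group on tuples of elements of a rack

Mathlib writes the operation of a rack as a left action: `y ◃ x` is the element usually written
`x ^ y` in the right-handed notation.  Mathlib's axiom `y ◃ (x ◃ z) = (y ◃ x) ◃ (y ◃ z)` is
`(z ^ x) ^ y = (z ^ y) ^ (x ^ y)`. -/

variable {X : Type u} [Rack X]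

/-- The effect of `σ_i` on tuples:
`(…, x_i, x_{i+1}, …) ↦ (…, x_{i+1}, x_i ^ x_{i+1}, …)`, the other entries being unchanged. -/
def move {n : ℕ} (i : Fin (n - 1)) : Equiv.Perm (Fin n → X) where
  toFun s k :=
    if k = left i then s (right i)
    else if k = right i then s (right i) ◃ s (left i)
    else s k
  invFun s k :=
    if k = left i then s (left i) ◃⁻¹ s (right i)
    else if k = right i then s (left i)
    else s k
  left_inv s := by
    funext k
    by_cases h1 : k = left i
    · simp [h1, right_ne_left]
    · by_cases h2 : k = right i <;> simp [h1, h2, right_ne_left]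
  right_inv s := by
    funext k
    by_cases h1 : k = left i
    · simp [h1, right_ne_left]
    · by_cases h2 : k = right i <;> simp [h1, h2, right_ne_left]

theorem move_apply {n : ℕ} (i : Fin (n - 1)) (s : Fin n → X) (k : Fin n) :
    move i s k = if k = left i then s (right i)
      else if k = right i then s (right i) ◃ s (left i) else s k := rfl

theorem actHom_relator {n : ℕ} (r : FreeGroup (Fin (n - 1))) (hr : IsRelator n r) :
    FreeGroup.lift (fun i => MulOpposite.op (move (X := X) i)) r = 1 := by
  cases hr with
  | comm i j h =>
    simp only [map_mul, map_inv, FreeGroup.lift_apply_of, mul_inv_eq_one, ← MulOpposite.op_mul]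
    congr 1
    ext s k
    have h1 : (j : ℕ) ≠ i := by omega
    have h2 : (j : ℕ) + 1 ≠ i := by omega
    have h3 : (j : ℕ) ≠ i + 1 := by omega
    simp only [Equiv.Perm.mul_apply, move_apply, left, right, Fin.ext_iff]
    split_ifs <;> first | rfl | omega
  | braid i j h =>
    simp only [map_mul, map_inv, FreeGroup.lift_apply_of, mul_inv_eq_one, ← MulOpposite.op_mul]
    congr 1
    have hl : left j = right i := by simp [left, right, h]
    have h1 : right i ≠ left i := right_ne_left i
    have h2 : right j ≠ right i := by simp [right, Fin.ext_iff]; omega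
    have h3 : right j ≠ left i := by simp [left, right, Fin.ext_iff]; omega
    ext s k
    simp only [Equiv.Perm.mul_apply, move_apply, hl]
    by_cases k1 : k = left i
    · subst k1; simp [h1.symm, h2, h3, h3.symm]
    by_cases k2 : k = right i
    · subst k2; simp [h1, h1.symm, h2, h3, h3.symm]
    by_cases k3 : k = right j
    · subst k3
      simp only [h1, h1.symm, h2, h2.symm, h3, h3.symm, if_true, if_false]
      exact Shelf.self_distrib
    simp [k1, k2, k3]

/-- The right action of `B_n` on `X ^ n`, as a homomorphism to the opposite of the group of
permutations of `X ^ n`. -/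
def actHom (X : Type u) [Rack X] (n : ℕ) : BraidGroup n →* (Equiv.Perm (Fin n → X))ᵐᵒᵖ :=
  PresentedGroup.toGroup (f := fun i => MulOpposite.op (move i)) actHom_relator

/-- The tuple `s ^ g`, for a tuple `s` of elements of a rack and a braid `g`. -/
def act {n : ℕ} (s : Fin n → X) (g : BraidGroup n) : Fin n → X := (actHom X n g).unop s

theorem act_one {n : ℕ} (s : Fin n → X) : act s 1 = s := by simp [act]

theorem act_mul {n : ℕ} (s : Fin n → X) (g h : BraidGroup n) :
    act s (g * h) = act (act s g) h := by simp [act]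

theorem act_sigma {n : ℕ} (s : Fin n → X) (i : Fin (n - 1)) (k : Fin n) :
    act s (sigma i) k = if k = left i then s (right i)
      else if k = right i then s (right i) ◃ s (left i) else s k := by
  have h : actHom X n (sigma i) = MulOpposite.op (move i) := PresentedGroup.toGroup.of _
  rw [act, h]
  rfl

/-- The stabilizer in `B_n` of a tuple `s`. -/
def stabilizer {n : ℕ} (s : Fin n → X) : Subgroup (BraidGroup n) where
  carrier := {g | act s g = s}
  one_mem' := act_one s
  mul_mem' {g h} hg hh := by
    change act s (g * h) = s
    rw [act_mul, show act s g = s from hg, show act s h = s from hh]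
  inv_mem' {g} hg := by
    change act s g⁻¹ = s
    conv_lhs => rw [← show act s g = s from hg]
    rw [← act_mul, mul_inv_cancel, act_one]

end Braid

/-! ### Connectedness and generation of finite racks -/

namespace FiniteRack

/-- The Schreier graph of a rack: the edges are the pairs `(x, x ^ y)`. -/
def schreierGraph (X : Type u) [Rack X] : Digraph X where
  Adj x z := ∃ y : X, z = y ◃ x

/-- A rack is connected if its Schreier graph is (weakly) connected. -/
def IsConnected (X : Type u) [Rack X] : Prop :=
  (schreierGraph X).toSimpleGraphInclusive.Connected

/-- A subset of a finite rack is a subrack if it is closed under the operation `x ^ y`. -/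
def IsSubrack {X : Type u} [Rack X] (X₀ : Set X) : Prop :=
  ∀ x ∈ X₀, ∀ y ∈ X₀, y ◃ x ∈ X₀

/-- The entries of a tuple generate a finite rack if no proper subrack contains all of them. -/
def Generates {X : Type u} [Rack X] {n : ℕ} (s : Fin n → X) : Prop :=
  ∀ X₀ : Set X, IsSubrack X₀ → (∀ i, s i ∈ X₀) → X₀ = Set.univ

/-- A rack is a quandle if `x ^ x = x` for all `x`. -/
def IsQuandle (X : Type u) [Rack X] : Prop := ∀ x : X, x ◃ x = x

end FiniteRack

/-! Let `m` be an even multiple of `|X|!`, so that acting `m` times by any element is trivial. For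
large `n` some colour `x` occurs at least `m + 1` times, and a braid brings these strands to the
left end; this only conjugates the monodromy group, and the new tuple still generates. A strand of
colour `w` can be passed through a block of `m` strands of colour `y` and back: the block becomes `w
◃ y`, while the strand, acted on `m` times by one element, keeps its colour. The braid used is pure.
The strands outside the block still generate, since one of them has colour `x`, so by connectedness
the block can take any colour (`exists_act_block_of_generates`). Three strands of one colour yield a
three-cycle (`swap_mul_swap_mem_monodromy`). Giving the block the colour of strand `j` therefore
yields a three-cycle on `0`, `1`, `j`, and these generate the alternating group. In a quandle, two
adjacent strands of equal colour also yield a transposition. -/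

/-! ### Generating alternating groups -/

namespace Equiv.Perm

variable {α : Type*} [Fintype α] [DecidableEq α]

/-- A subgroup that contains the three-cycles through two given points contains the alternating
group. -/
theorem alternatingGroup_le_of_swap_mul_swap_mem {K : Subgroup (Perm α)} {a b : α} (hab : a ≠ b)
    (h : ∀ c, c ≠ a → c ≠ b → swap b c * swap b a ∈ K) : alternatingGroup α ≤ K := by
  have h' : ∀ c, c ≠ b → swap b c * swap b a ∈ K := fun c hc => by
    by_cases hca : c = a
    · subst hca; simp
    · exact h c hca hc
  -- The transpositions through `b` generate the symmetric group. An odd product of them is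
  -- corrected by `swap b a`, so that membership in `K` can be followed one factor at a time.
  let P : Perm α → Prop := fun π => (sign π = 1 → π ∈ K) ∧ (sign π = -1 → swap b a * π ∈ K)
  have step : ∀ c, c ≠ b → ∀ π, P π → P (swap b c * π) := by
    intro c hc π hπ
    refine ⟨fun hs => ?_, fun hs => ?_⟩
    · rw [sign_mul, sign_swap hc.symm] at hs
      have : sign π = -1 := by simpa [neg_eq_iff_eq_neg] using hs
      have := K.mul_mem (h' c hc) (hπ.2 this)
      rwa [mul_assoc, ← mul_assoc (swap b a), swap_mul_self, one_mul] at this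
    · rw [sign_mul, sign_swap hc.symm] at hs
      have : sign π = 1 := by simpa using hs
      have := K.mul_mem (K.inv_mem (h' c hc)) (hπ.1 this)
      rwa [mul_inv_rev, swap_inv, swap_inv, mul_assoc] at this
  have all : ∀ π, P π := by
    intro π
    induction π using swap_induction_on with
    | one => exact ⟨fun _ => K.one_mem, fun hs => by simp at hs⟩
    | swap_mul π x y hxy hπ =>
      by_cases hx : x = b
      · subst hx; exact step y hxy.symm π hπ
      by_cases hy : y = b
      · subst hy; rw [swap_comm]; exact step x hxy π hπ
      have e : swap x y = swap b x * swap b y * swap b x := by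
        have := swap_apply_apply (swap b x) b y
        rwa [swap_apply_left, swap_apply_of_ne_of_ne hy hxy.symm, swap_inv] at this
      rw [e, mul_assoc, mul_assoc]
      exact step x hx _ (step y hy _ (step x hx _ hπ))
  exact fun π hπ => (all π).1 (mem_alternatingGroup.1 hπ)

/-- A subgroup that contains the alternating group and an odd permutation is everything. -/
theorem eq_top_of_alternatingGroup_le {K : Subgroup (Perm α)} (hK : alternatingGroup α ≤ K)
    {τ : Perm α} (hτ : τ ∈ K) (hs : sign τ = -1) : K = ⊤ := by
  refine eq_top_iff.2 fun π _ => ?_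
  rcases Int.units_eq_one_or (sign π) with h | h
  · exact hK (mem_alternatingGroup.2 h)
  · have : π * τ⁻¹ ∈ K := hK (mem_alternatingGroup.2 (by simp [h, hs]))
    simpa using K.mul_mem this hτ

theorem eq_alternatingGroup_or_eq_top {K : Subgroup (Perm α)} (hK : alternatingGroup α ≤ K) :
    K = alternatingGroup α ∨ K = ⊤ := by
  by_cases h : ∃ τ ∈ K, sign τ = -1
  · obtain ⟨τ, hτ, hs⟩ := h
    exact Or.inr (eq_top_of_alternatingGroup_le hK hτ hs)
  · refine Or.inl (le_antisymm (fun π hπ => ?_) hK)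
    rcases Int.units_eq_one_or (sign π) with h1 | h1
    · exact mem_alternatingGroup.2 h1
    · exact absurd ⟨π, hπ, h1⟩ h

end Equiv.Perm

/-! ### Stable subsets of finite racks -/

namespace FiniteRack

variable {X : Type u} [Rack X]

/-- In a finite rack a set mapped into itself by `z ↦ w ◃ z` contains `z` along with `w ◃ z`. -/
theorem mem_of_act_mem [Finite X] {O : Set X} {w : X} (h : ∀ z ∈ O, w ◃ z ∈ O) {z : X}
    (hz : w ◃ z ∈ O) : z ∈ O := by
  have hinj : Function.Injective fun z : X => w ◃ z := fun a b hab => by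
    exact (Rack.left_cancel w).1 hab
  have himg : (fun z : X => w ◃ z) '' O = O :=
    Set.eq_of_subset_of_ncard_le (Set.image_subset_iff.2 h)
      (Set.ncard_image_of_injective O hinj).ge (Set.toFinite O)
  rw [← himg] at hz
  obtain ⟨z', hz', e⟩ := hz
  exact hinj e ▸ hz'

/-- A nonempty subset of a connected finite rack that is stable under the action of a family of
generators is everything. -/
theorem eq_univ_of_stable [Finite X] (hX : IsConnected X) {O : Set X} (hO : O.Nonempty)
    {G : Set X} (hG : ∀ X₀ : Set X, IsSubrack X₀ → G ⊆ X₀ → X₀ = Set.univ)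
    (h : ∀ w ∈ G, ∀ z ∈ O, w ◃ z ∈ O) : O = Set.univ := by
  -- By self-distributivity, the elements mapping `O` into itself form a subrack.
  have hall : {w : X | ∀ z ∈ O, w ◃ z ∈ O} = Set.univ := by
    refine hG _ (fun x hx y hy z hz => ?_) h
    obtain ⟨z', rfl⟩ : ∃ z', y ◃ z' = z := ⟨y ◃⁻¹ z, by simp⟩
    rw [← Shelf.self_distrib]
    exact hy _ (hx _ (mem_of_act_mem hy hz))
  have hst : ∀ w, ∀ z ∈ O, w ◃ z ∈ O := fun w => by
    have : w ∈ {w : X | ∀ z ∈ O, w ◃ z ∈ O} := hall ▸ Set.mem_univ w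
    exact this
  obtain ⟨z₀, hz₀⟩ := hO
  refine Set.eq_univ_of_forall fun z => ?_
  obtain ⟨p⟩ := hX.preconnected z₀ z
  induction p with
  | nil => exact hz₀
  | cons hadj _ ih =>
    apply ih
    -- Connectedness is weak, so an edge may be traversed backwards; finiteness makes `O` stable
    -- under that as well.
    rcases hadj.2 with ⟨y, rfl⟩ | ⟨y, hy⟩
    · exact hst y _ hz₀
    · exact mem_of_act_mem (hst y) (hy ▸ hz₀)

end FiniteRack

/-! ### Braids that move strands -/

namespace Braid

variable {X : Type u} [Rack X] {n : ℕ}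

/-- The generator exchanging the positions `i` and `i + 1`, or `1` if there is none. -/
def gen (n i : ℕ) : BraidGroup n := if h : i < n - 1 then sigma ⟨i, h⟩ else 1

theorem act_gen (s : Fin n → X) {i : ℕ} (h : i + 1 < n) (k : Fin n) :
    act s (gen n i) k = if (k : ℕ) = i then s ⟨i + 1, h⟩
      else if (k : ℕ) = i + 1 then s ⟨i + 1, h⟩ ◃ s ⟨i, by omega⟩ else s k := by
  rw [gen, dif_pos (show i < n - 1 by omega), act_sigma]
  simp [left, right, Fin.ext_iff]

theorem toPerm_gen {i : ℕ} (h : i + 1 < n) :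
    toPerm n (gen n i) = Equiv.swap ⟨i, by omega⟩ ⟨i + 1, h⟩ := by
  rw [gen, dif_pos (show i < n - 1 by omega), toPerm_sigma]
  rfl

theorem toPerm_gen_mul_self (i : ℕ) : toPerm n (gen n i) * toPerm n (gen n i) = 1 := by
  by_cases h : i + 1 < n
  · rw [toPerm_gen h, Equiv.swap_mul_self]
  · rw [gen, dif_neg (by omega)]; simp

/-- The braid moving the strand at position `i + d` to position `i`, its colour unchanged. -/
def pull (n i : ℕ) : ℕ → BraidGroup n
  | 0 => 1
  | d + 1 => gen n (i + d) * pull n i d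

/-- The braid moving the strand at position `i` to position `i + d`, the colours of the others
unchanged. -/
def push (n i : ℕ) : ℕ → BraidGroup n
  | 0 => 1
  | d + 1 => push n i d * gen n (i + d)

theorem pull_add (i d e : ℕ) : pull n i (d + e) = pull n (i + d) e * pull n i d := by
  induction e with
  | zero => simp [pull]
  | succ e ih => rw [← add_assoc, pull, ih, pull, mul_assoc, add_assoc]

/-- The generators become involutions in the symmetric group. In the braid group the product need
not be trivial, which leaves room for pure braids that recolour. -/
theorem toPerm_pull_mul_push (i d : ℕ) : toPerm n (pull n i d) * toPerm n (push n i d) = 1 := by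
  rw [← mul_eq_one_comm]
  induction d with
  | zero => simp [pull, push]
  | succ d ih =>
    rw [pull, push, map_mul, map_mul, mul_assoc, ← mul_assoc (toPerm n (gen n _)),
      toPerm_gen_mul_self, one_mul, ih]

theorem act_pull (s : Fin n → X) {i d : ℕ} (h : i + d < n) (k : Fin n) :
    act s (pull n i d) k = if (k : ℕ) < i then s k else if (k : ℕ) = i then s ⟨i + d, h⟩
      else if (k : ℕ) ≤ i + d then s ⟨i + d, h⟩ ◃ s ⟨k - 1, by omega⟩ else s k := by
  induction d generalizing s with
  | zero =>
    simp only [pull, act_one, add_zero]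
    split_ifs with h1 h2 h3
    · rfl
    · congr 1; exact Fin.ext h2
    · omega
    · rfl
  | succ d ih =>
    rw [pull, act_mul, ih _ (by omega)]
    simp only [act_gen s (show i + d + 1 < n by omega)]
    split_ifs <;> first | rfl | omega | skip
    have e : (⟨k - 1, by omega⟩ : Fin n) = ⟨i + d, by omega⟩ := Fin.ext (by simp; omega)
    rw [e]; rfl

/-- In this convention `toPerm n g k` is the initial position of the strand that `g` brings to
position `k`. -/
theorem toPerm_pull {i d : ℕ} (h : i + d < n) (k : Fin n) :
    ((k : ℕ) < i ∨ i + d < k → toPerm n (pull n i d) k = k) ∧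
      ((k : ℕ) = i → toPerm n (pull n i d) k = ⟨i + d, h⟩) := by
  induction d with
  | zero => exact ⟨fun _ => by simp [pull], fun hk => by simpa [pull, Fin.ext_iff] using hk⟩
  | succ d ih =>
    have ih := ih (by omega)
    rw [pull, map_mul, toPerm_gen (show i + d + 1 < n by omega), Equiv.Perm.mul_apply]
    refine ⟨fun hk => ?_, fun hk => ?_⟩
    · rw [ih.1 (by omega), Equiv.swap_apply_of_ne_of_ne] <;> simp [Fin.ext_iff] <;> omega
    · rw [ih.2 hk, Equiv.swap_apply_left]; rfl

/-- The effect of moving the strand at position `0` through a block of strands of one colour. -/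
theorem act_push_of_const (s : Fin n → X) {d : ℕ} (h : d < n) {y : X}
    (hy : ∀ k : Fin n, 0 < (k : ℕ) → (k : ℕ) ≤ d → s k = y) (k : Fin n) :
    act s (push n 0 d) k = if (k : ℕ) < d then y
      else if (k : ℕ) = d then (fun z => y ◃ z)^[d] (s ⟨0, by omega⟩) else s k := by
  induction d generalizing k with
  | zero =>
    simp only [push, act_one, Nat.not_lt_zero, if_false, Function.iterate_zero, id]
    split_ifs with h1
    · congr 1; exact Fin.ext h1
    · rfl
  | succ d ih =>
    have ih := ih (by omega) fun k h1 h2 => hy k h1 (by omega)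
    rw [push, act_mul, act_gen _ (show 0 + d + 1 < n by omega)]
    simp only [ih, zero_add]
    have e := hy ⟨d + 1, h⟩ (by simp) (by simp)
    simp only [e, Function.iterate_succ', Function.comp_apply]
    split_ifs <;> first | rfl | omega

/-- Any set of strands can be moved to the left, their order and their colours unchanged. -/
theorem exists_act_eq_comp (s : Fin n → X) {M : ℕ} (hM : M ≤ n) (f : Fin M → Fin n)
    (hf : StrictMono f) :
    ∃ g : BraidGroup n, ∀ k : Fin M, act s g (k.castLE hM) = s (f k) ∧
      toPerm n g (k.castLE hM) = f k := by
  -- The induction needs that nothing to the right of the chosen strands is disturbed: the next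
  -- chosen strand is then still in place.
  suffices ∃ g : BraidGroup n, (∀ k : Fin M, act s g (k.castLE hM) = s (f k) ∧
      toPerm n g (k.castLE hM) = f k) ∧
      ∀ k : Fin n, (∀ i, f i < k) → act s g k = s k ∧ toPerm n g k = k from
    this.imp fun _ h => h.1
  induction M with
  | zero => exact ⟨1, fun k => k.elim0, fun k _ => by simp [act_one]⟩
  | succ M ih =>
    obtain ⟨g, hg1, hg2⟩ := ih (by omega) (fun i => f i.castSucc)
      (hf.comp Fin.strictMono_castSucc)
    have hle : M ≤ f (Fin.last M) := by
      have h (i : Fin (M + 1)) : (i : ℕ) ≤ f i := by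
        induction i using Fin.induction with
        | zero => simp
        | succ i ih =>
          have : f i.castSucc < f i.succ := hf i.castSucc_lt_succ
          rw [Fin.val_castSucc] at ih
          rw [Fin.val_succ]
          omega
      exact h (Fin.last M)
    obtain ⟨d, hd⟩ := Nat.exists_eq_add_of_le hle
    have hlt : M + d < n := hd ▸ (f (Fin.last M)).2
    have hj : (⟨M + d, hlt⟩ : Fin n) = f (Fin.last M) := Fin.ext hd.symm
    have hlast := hg2 (f (Fin.last M)) fun i => hf i.castSucc_lt_last
    refine ⟨g * pull n M d, fun k => ?_, fun k hk => ?_⟩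
    · rw [act_mul, act_pull _ hlt, map_mul, Equiv.Perm.mul_apply]
      induction k using Fin.lastCases with
      | last =>
        rw [(toPerm_pull hlt _).2 (by simp), hj]
        simpa using hlast
      | cast k =>
        rw [(toPerm_pull hlt _).1 (by left; simp), if_pos (by simp)]
        exact hg1 k
    · have h1 := hk (Fin.last M)
      rw [Fin.lt_def, hd] at h1
      have h2 := hg2 k fun i => hk _
      rw [act_mul, act_pull _ hlt, map_mul, Equiv.Perm.mul_apply,
        (toPerm_pull hlt _).1 (Or.inr h1), if_neg (by omega), if_neg (by omega),
        if_neg (by omega)]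
      exact h2

/-! ### Monodromy groups and three-cycles -/

/-- The permutations induced by the stabilizer of a tuple. -/
def monodromy (s : Fin n → X) : Subgroup (Equiv.Perm (Fin n)) := (stabilizer s).map (toPerm n)

theorem toPerm_mem_monodromy {s : Fin n → X} {g : BraidGroup n} (h : act s g = s) :
    toPerm n g ∈ monodromy s := ⟨g, h, rfl⟩

theorem conj_mem_monodromy {s : Fin n → X} (g : BraidGroup n) {π : Equiv.Perm (Fin n)}
    (h : π ∈ monodromy (act s g)) : toPerm n g * π * (toPerm n g)⁻¹ ∈ monodromy s := by
  obtain ⟨b, hb, rfl⟩ := h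
  rw [← map_inv, ← map_mul, ← map_mul]
  apply toPerm_mem_monodromy
  rw [act_mul, act_mul, show act (act s g) b = act s g from hb, ← act_mul, mul_inv_cancel, act_one]

/-- Tuples in one orbit have conjugate monodromy groups, and the alternating group is normal. -/
theorem alternatingGroup_le_monodromy_of_act {s : Fin n → X} (g : BraidGroup n)
    (h : alternatingGroup (Fin n) ≤ monodromy (act s g)) :
    alternatingGroup (Fin n) ≤ monodromy s := fun π hπ => by
  have h1 : (toPerm n g)⁻¹ * π * toPerm n g ∈ alternatingGroup (Fin n) := by
    rw [Equiv.Perm.mem_alternatingGroup] at hπ ⊢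
    simp [hπ]
  simpa [mul_assoc] using conj_mem_monodromy g (h h1)

/-- Three strands of equal colours give a three-cycle. -/
theorem swap_mul_swap_mem_monodromy {s : Fin n → X} {a b c : Fin n} (hab : a < b) (hbc : b < c)
    (h1 : s a = s b) (h2 : s b = s c) : Equiv.swap b c * Equiv.swap b a ∈ monodromy s := by
  have hn : 3 ≤ n := by omega
  have hf : StrictMono ![a, b, c] := by
    intro i j hij
    fin_cases i <;> fin_cases j <;> simp at hij ⊢ <;> first | assumption | exact hab.trans hbc
  obtain ⟨g, hg⟩ := exists_act_eq_comp s hn _ hf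
  have e0 := hg 0
  have e1 := hg 1
  have e2 := hg 2
  set r := act s g with hr
  let p0 : Fin n := ⟨0, by omega⟩
  let p1 : Fin n := ⟨1, by omega⟩
  let p2 : Fin n := ⟨2, by omega⟩
  have r0 : r p0 = s a := e0.1
  have r1 : r p1 = s a := e1.1.trans h1.symm
  have r2 : r p2 = s a := e2.1.trans (h1.trans h2).symm
  have t0 : toPerm n g p0 = a := e0.2
  have t1 : toPerm n g p1 = b := e1.2
  have t2 : toPerm n g p2 = c := e2.2
  -- Both braids turn `(x, x, x)` into `(x, x ◃ x, x ◃ x)`, because `x ◃ x` acts in the same way as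
  -- `x`. Their quotient maps to a three-cycle, as the square becomes trivial in the symmetric
  -- group.
  have key : act r (gen n 1 * gen n 0) = act r (gen n 1 * gen n 1) := by
    ext k
    simp only [act_mul, act_gen _ (show 1 + 1 < n by omega), act_gen _ (show 0 + 1 < n by omega)]
    change r ⟨0, _⟩ = _ at r0
    change r ⟨1, _⟩ = _ at r1
    change r ⟨2, _⟩ = _ at r2
    by_cases k0 : (k : ℕ) = 0
    · simp [k0, r2, show r k = s a from (congrArg r (Fin.ext k0)).trans r0]
    by_cases k1 : (k : ℕ) = 1
    · simp [k1, r0, r1, r2]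
    by_cases k2 : (k : ℕ) = 2
    · simp [k2, r1, r2, Rack.self_act_act_eq]
    simp [k0, k1, k2]
  have hst : act r (gen n 1 * gen n 0 * (gen n 1 * gen n 1)⁻¹) = r := by
    rw [act_mul, key, ← act_mul, mul_inv_cancel, act_one]
  have hm := conj_mem_monodromy g (toPerm_mem_monodromy hst)
  rw [map_mul, map_inv, map_mul _ (gen n 1) (gen n 1), toPerm_gen_mul_self, inv_one, mul_one,
    map_mul, toPerm_gen (show 1 + 1 < n by omega), toPerm_gen (show 0 + 1 < n by omega)] at hm
  have e : toPerm n g * (Equiv.swap p1 p2 * Equiv.swap p0 p1) * (toPerm n g)⁻¹ =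
      Equiv.swap b c * Equiv.swap b a := by
    rw [← t0, ← t1, ← t2, Equiv.swap_comm (toPerm n g p1) (toPerm n g p0),
      Equiv.swap_apply_apply, Equiv.swap_apply_apply]
    group
  rw [← e]
  exact hm

/-! ### Recolouring a block by pure braids -/

/-- A block of `m` strands of colour `x` at the left end can be recoloured by the colour of a
strand outside it, if `m`-fold action is trivial. -/
theorem exists_act_block [Finite X] {m : ℕ} (hm : ∀ y z : X, (fun z => y ◃ z)^[m] z = z)
    (s : Fin n → X) {j : Fin n} (hj : m ≤ j) (y : X) :
    ∃ g : BraidGroup n, toPerm n g = 1 ∧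
      act (fun k : Fin n => if (k : ℕ) < m then y else s k) g =
        fun k : Fin n => if (k : ℕ) < m then s j ◃ y else s k := by
  obtain ⟨d, hd⟩ := Nat.exists_eq_add_of_le hj
  have hlt : m + d < n := hd ▸ j.2
  have hj' : (⟨m + d, hlt⟩ : Fin n) = j := Fin.ext hd.symm
  -- Strand `j` is pulled to the left end, acting on all it passes, then pushed back through the
  -- block, which has become `s j ◃ y` and acts on it `m` times, hence trivially. The last factor
  -- returns it to its place and restores the strands between.
  refine ⟨pull n 0 (m + d) * push n 0 m * (pull n m d)⁻¹, ?_, ?_⟩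
  · rw [pull_add, map_mul, map_mul, map_mul, mul_assoc (toPerm n _), toPerm_pull_mul_push, zero_add,
      mul_one, map_inv, mul_inv_cancel]
  · rw [act_mul]
    have key : act (fun k : Fin n => if (k : ℕ) < m then y else s k)
        (pull n 0 (m + d) * push n 0 m) =
        act (fun k : Fin n => if (k : ℕ) < m then s j ◃ y else s k) (pull n m d) := by
      ext k
      have hp := act_pull (fun k : Fin n => if (k : ℕ) < m then y else s k)
        (show 0 + (m + d) < n by omega)
      rw [act_mul, act_push_of_const _ (show m < n by omega) (y := s j ◃ y), act_pull _ hlt, hm]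
      · simp only [hp, zero_add, hj']
        split_ifs <;> first | rfl | omega
      · intro k h1 h2
        rw [hp]
        simp only [zero_add, hj']
        have : ¬ (j : ℕ) < m := by omega
        have h3 : (k : ℕ) - 1 < m := by omega
        have h4 : (k : ℕ) ≠ 0 := by omega
        have h5 : (k : ℕ) ≤ m + d := by omega
        simp [h3, h4, h5]
    rw [key, ← act_mul, mul_inv_cancel, act_one]

/-- A block of strands of one colour at the left end can be given any other colour, if the other
strands generate. -/
theorem exists_act_block_of_generates [Finite X] (hX : FiniteRack.IsConnected X) {m : ℕ}
    (hm : ∀ y z : X, (fun z => y ◃ z)^[m] z = z) (s : Fin n → X)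
    (hs : ∀ X₀ : Set X, FiniteRack.IsSubrack X₀ → (∀ k : Fin n, m ≤ k → s k ∈ X₀) →
      X₀ = Set.univ)
    {x : X} (hx : ∀ k : Fin n, (k : ℕ) < m → s k = x) (y : X) :
    ∃ g : BraidGroup n, toPerm n g = 1 ∧
      act s g = fun k : Fin n => if (k : ℕ) < m then y else s k := by
  have : {y : X | ∃ g : BraidGroup n, toPerm n g = 1 ∧
      act s g = fun k : Fin n => if (k : ℕ) < m then y else s k} = Set.univ := by
    -- The colours the block can attain are stable under the colours outside it, which generate.
    refine FiniteRack.eq_univ_of_stable hX (G := s '' {k | m ≤ (k : ℕ)}) ⟨x, 1, map_one _, ?_⟩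
      (fun X₀ h0 h1 => hs X₀ h0 fun k hk => h1 ⟨k, hk, rfl⟩) ?_
    · ext k
      rw [act_one]
      split_ifs with h
      · exact hx k h
      · rfl
    · rintro _ ⟨j, hj, rfl⟩ z ⟨g, hg, hz⟩
      obtain ⟨b, hb, hb'⟩ := exists_act_block hm s hj z
      exact ⟨g * b, by rw [map_mul, hg, hb, mul_one], by rw [act_mul, hz, hb']⟩
  exact this.ge (Set.mem_univ y)

/-- A tuple and its translate under a braid lie in the same subracks. -/
theorem forall_act_mem_iff [Finite X] {X₀ : Set X} (h : FiniteRack.IsSubrack X₀)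
    (g : BraidGroup n) (s : Fin n → X) : (∀ k, act s g k ∈ X₀) ↔ ∀ k, s k ∈ X₀ := by
  -- The braids with this property form a subgroup, so checking the generators suffices.
  let S : Subgroup (BraidGroup n) :=
    { carrier := {g | ∀ s : Fin n → X, (∀ k, act s g k ∈ X₀) ↔ ∀ k, s k ∈ X₀}
      one_mem' := fun s => by rw [act_one]
      mul_mem' := fun {a b} ha hb s => by rw [act_mul, hb, ha]
      inv_mem' := fun {a} ha s => by rw [← ha, ← act_mul, inv_mul_cancel, act_one] }
  have hS : S = ⊤ := by
    rw [eq_top_iff, ← PresentedGroup.closure_range_of, Subgroup.closure_le]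
    rintro _ ⟨i, rfl⟩ s
    change (∀ k, act s (sigma i) k ∈ X₀) ↔ _
    simp only [act_sigma]
    constructor
    · intro hk
      have hr : s (right i) ∈ X₀ := by simpa using hk (left i)
      have hl : s (left i) ∈ X₀ := by
        have := hk (right i)
        rw [if_neg (right_ne_left i), if_pos rfl] at this
        exact FiniteRack.mem_of_act_mem (fun z hz => h z hz _ hr) this
      intro k
      have := hk k
      split_ifs at this with h1 h2
      · exact h1 ▸ hl
      · exact h2 ▸ hr
      · exact this
    · intro hk k
      split_ifs
      · exact hk _
      · exact h _ (hk _) _ (hk _)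
      · exact hk _
  exact (hS ▸ Subgroup.mem_top g : g ∈ S) s

/-- A tuple that starts with sufficiently many equal entries, which are repeated later on, has
all even permutations in its monodromy. -/
theorem alternatingGroup_le_monodromy_of_block [Finite X] (hX : FiniteRack.IsConnected X) {m : ℕ}
    (h2 : 2 ≤ m) (hm : ∀ y z : X, (fun z => y ◃ z)^[m] z = z) (hn : m < n) {s : Fin n → X}
    (hs : FiniteRack.Generates s) {x : X} (hx : ∀ k : Fin n, (k : ℕ) ≤ m → s k = x) :
    alternatingGroup (Fin n) ≤ monodromy s := by
  refine Equiv.Perm.alternatingGroup_le_of_swap_mul_swap_mem (a := ⟨0, by omega⟩)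
    (b := ⟨1, by omega⟩) (by simp) fun j hj0 hj1 => ?_
  have h0 : (⟨0, by omega⟩ : Fin n) < ⟨1, by omega⟩ := by simp
  have h1 : (⟨1, by omega⟩ : Fin n) < j := by
    simp only [ne_eq, Fin.ext_iff] at hj0 hj1
    rw [Fin.lt_def]
    simp only
    omega
  -- Strand `m` lies outside the block and has its colour `x`, so dropping the block loses no
  -- generator.
  have hs' : ∀ X₀ : Set X, FiniteRack.IsSubrack X₀ → (∀ k : Fin n, m ≤ k → s k ∈ X₀) →
      X₀ = Set.univ := fun X₀ h0 hk => hs X₀ h0 fun k => by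
    rcases le_or_gt m k with h | h
    · exact hk k h
    · rw [hx k h.le, ← hx ⟨m, hn⟩ le_rfl]
      exact hk _ le_rfl
  rcases lt_or_ge (j : ℕ) m with hj | hj
  · refine swap_mul_swap_mem_monodromy h0 h1 ?_ ?_ <;>
      rw [hx _ (by omega), hx _ (by omega)]
  -- The recolouring braid is pure, so conjugation by it leaves the three-cycle unchanged.
  · obtain ⟨g, hg, hg'⟩ := exists_act_block_of_generates hX hm s hs' (fun k hk => hx k hk.le) (s j)
    have := conj_mem_monodromy (s := s) g (π := Equiv.swap ⟨1, by omega⟩ j *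
      Equiv.swap ⟨1, by omega⟩ ⟨0, by omega⟩) ?_
    · simpa [hg] using this
    · rw [hg']
      have h3 : ¬ (j : ℕ) < m := by omega
      have h4 : 1 < m := by omega
      have h5 : 0 < m := by omega
      exact swap_mul_swap_mem_monodromy h0 h1 (by simp [h4, h5]) (by simp [h3, h4])

end Braid

/-! ### The main theorem -/

theorem theorem2 :
    ∃ N : ℕ → ℕ, ∀ (X : Type u) [Finite X] [Rack X], FiniteRack.IsConnected X →
      ∀ n : ℕ, N (Nat.card X) ≤ n → ∀ s : Fin n → X, FiniteRack.Generates s →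
        ((Braid.stabilizer s).map (Braid.toPerm n) = alternatingGroup (Fin n) ∨
          (Braid.stabilizer s).map (Braid.toPerm n) = ⊤) ∧
        (FiniteRack.IsQuandle X →
          (Braid.stabilizer s).map (Braid.toPerm n) = ⊤) := by
  classical
  refine ⟨fun c => c * (2 * c.factorial) + 1, fun X _ _ hX n hn s hs => ?_⟩
  have := Fintype.ofFinite X
  -- The factorial is the order of the symmetric group on `X`, so it kills every action. The factor
  -- `2` ensures that positions `0` and `1` both lie in the block.
  set m := 2 * (Nat.card X).factorial with hmdef
  have h2 : 2 ≤ m := by have := Nat.factorial_pos (Nat.card X); omega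
  have hm : ∀ y z : X, (fun z => y ◃ z)^[m] z = z := fun y z => by
    have h : Rack.act' y ^ m = 1 := by
      rw [hmdef, Nat.card_eq_fintype_card, mul_comm, pow_mul, ← Fintype.card_perm, pow_card_eq_one,
        one_pow]
    have := congrArg (fun e : Equiv.Perm X => e z) h
    rwa [Equiv.Perm.coe_one, id, ← Equiv.Perm.iterate_eq_pow] at this
  -- By pigeonhole a colour occurs more than `m` times: `m` strands for the block and one to stay
  -- outside.
  obtain ⟨x, hx⟩ := Fintype.exists_lt_card_fiber_of_mul_lt_card (f := s) (n := m)
    (by rw [Fintype.card_fin, ← Nat.card_eq_fintype_card]; exact hn)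
  have hmn : m + 1 ≤ n := hx.trans_le ((Finset.card_le_univ _).trans (Fintype.card_fin n).le)
  obtain ⟨t, ht, htc⟩ := Finset.exists_subset_card_eq (Nat.succ_le_of_lt hx)
  obtain ⟨g, hg⟩ := Braid.exists_act_eq_comp s hmn (t.orderEmbOfFin htc)
    (t.orderEmbOfFin htc).strictMono
  have hblock : ∀ k : Fin n, (k : ℕ) ≤ m → Braid.act s g k = x := fun k hk => by
    refine ((hg ⟨k, by omega⟩).1).trans ?_
    simpa using ht (t.orderEmbOfFin_mem htc ⟨k, by omega⟩)
  have hA := Braid.alternatingGroup_le_monodromy_of_act g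
    (Braid.alternatingGroup_le_monodromy_of_block hX h2 hm (by omega)
      (fun X₀ h0 h1 => hs X₀ h0 ((Braid.forall_act_mem_iff h0 g s).1 h1)) hblock)
  refine ⟨Equiv.Perm.eq_alternatingGroup_or_eq_top hA, fun hQ => ?_⟩
  -- In a quandle, crossing two strands of equal colour changes nothing, which gives an odd
  -- permutation.
  have hfix : Braid.act (Braid.act s g) (Braid.gen n 0) = Braid.act s g := by
    ext k
    have hlt : 0 + 1 < n := by omega
    rw [Braid.act_gen _ hlt, hblock _ (by simp; omega), hblock _ (by simp), hQ]
    split_ifs with h1 h2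
    · exact (hblock k (by omega)).symm
    · exact (hblock k (by omega)).symm
    · rfl
  refine Equiv.Perm.eq_top_of_alternatingGroup_le hA
    (Braid.conj_mem_monodromy g (Braid.toPerm_mem_monodromy hfix)) ?_
  rw [Braid.toPerm_gen (show 0 + 1 < n by omega)]
  simp
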